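/- Let $G$ be a compact connected simple Lie group with Lie algebra $\mathfrak g$, and let $K\subsetneq G$ be a proper closed subgroup with Lie algebra $\mathfrak k$ which is naturally reductive: there is a splitting $\mathfrak g=\mathfrak k\oplus\mathfrak m$, orthogonal with respect to the Killing form, with $[\mathfrak k,\mathfrak m]\subset\mathfrak m$. Let $(V,\rho)$ be a finite-dimensional continuous real representation of $K$, and let $G\times_K V\to G/K$ be the homogeneous vector bundle of classes $[g,v]=[gk^{-1},\rho(k)v]$, $k\in K$. Its smooth sections $s$ are identified with the smooth maps $f:G\to V$ satisfying $f(gk)=\rho(k)^{-1}f(g)$ through $s(gK)=[g,f(g)]$; $G$ acts on them by $(g\cdot f)(h)=f(g^{-1}h)$, and the canonical connection $\nabla^-$ is given by $\nabla^-_Xf=X_L(f)$ for $X\in\mathfrak m$, where $X_L$ is the left-invariant vector field on $G$ with value $X$ at the identity. Then $v\mapsto\big(gK\mapsto[g,v]\big)$ is a bijection from the space $V^K$ of $K$-invariant vectors onto the set of $\nabla^-$-parallel smooth sections of $G\times_K V$, and a smooth section is $\nabla^-$-parallel if and only if it is $G$-invariant. -/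

import Mathlib

open scoped Manifold ContDiff

noncomputable section

namespace HomogeneousBundle

/-! ### The Lie algebra of a subgroup and naturally reductive splittings -/

section LieAlgebra

variable {n : ℕ} {G : Type*} [TopologicalSpace G] [ChartedSpace (EuclideanSpace ℝ (Fin n)) G]

/-- The velocity `γ'(0)` of a curve in `G`. Tangent spaces of `G` are modelled on `ℝⁿ`; if
`γ 0 = 1` then this is an element of `T₁G`. -/
def curveVelocity (γ : ℝ → G) : EuclideanSpace ℝ (Fin n) :=
  mfderiv 𝓘(ℝ, ℝ) (𝓡 n) γ 0 (1 : ℝ)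

theorem curveVelocity_comp_mul {γ : ℝ → G} (hγ : ContMDiff 𝓘(ℝ, ℝ) (𝓡 n) ∞ γ) (c : ℝ) :
    curveVelocity (n := n) (fun t => γ (c * t)) = c • curveVelocity γ := by
  have hd : HasMFDerivAt 𝓘(ℝ, ℝ) 𝓘(ℝ, ℝ) (fun t : ℝ => c * t) 0
      (c • ContinuousLinearMap.id ℝ ℝ) :=
    ((hasFDerivAt_id (𝕜 := ℝ) (0 : ℝ)).const_mul c).hasMFDerivAt
  have h1 : HasMFDerivAt 𝓘(ℝ, ℝ) (𝓡 n) γ (c * 0) (mfderiv 𝓘(ℝ, ℝ) (𝓡 n) γ (c * 0)) :=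
    (hγ.mdifferentiableAt (by simp)).hasMFDerivAt
  have h2 := (HasMFDerivAt.comp (0 : ℝ) h1 hd).mfderiv
  refine Eq.trans (DFunLike.congr_fun h2 (1 : ℝ)) ?_
  have h3 : (mfderiv 𝓘(ℝ, ℝ) (𝓡 n) γ (c * 0) (c • (1 : ℝ)) : EuclideanSpace ℝ (Fin n)) =
      c • (mfderiv 𝓘(ℝ, ℝ) (𝓡 n) γ (c * 0) (1 : ℝ) : EuclideanSpace ℝ (Fin n)) :=
    map_smul (mfderiv 𝓘(ℝ, ℝ) (𝓡 n) γ (c * 0)) c (1 : ℝ)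
  rw [mul_zero] at h3
  refine Eq.trans ?_ h3
  rw [mul_zero]
  rfl

variable [Group G]

/-- Smoothness `∞` supplies the smoothness under which Mathlib defines the Lie algebra of a real
Lie group (over `ℝ` the number `minSmoothness ℝ 3` is `3`). -/
instance instLieGroupMinSmoothness [LieGroup (𝓡 n) ∞ G] :
    LieGroup (𝓡 n) (minSmoothness ℝ 3) G :=
  LieGroup.of_le (n := ∞) (by
    rw [minSmoothness_of_isRCLikeNormedField]; exact ENat.LEInfty.out)

variable [LieGroup (𝓡 n) ∞ G]

theorem curveVelocity_mul {γ δ : ℝ → G} (hγ : ContMDiff 𝓘(ℝ, ℝ) (𝓡 n) ∞ γ)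
    (hδ : ContMDiff 𝓘(ℝ, ℝ) (𝓡 n) ∞ δ) (hγ0 : γ 0 = 1) (hδ0 : δ 0 = 1) :
    curveVelocity (n := n) (fun t => γ t * δ t) = curveVelocity γ + curveVelocity δ := by
  have hm : MDifferentiableAt ((𝓡 n).prod (𝓡 n)) (𝓡 n) (fun p : G × G => p.1 * p.2)
      (γ 0, δ 0) := (contMDiff_mul (𝓡 n) ∞).mdifferentiableAt (by simp)
  have h1 : MDifferentiableAt 𝓘(ℝ, ℝ) (𝓡 n) γ 0 := hγ.mdifferentiableAt (by simp)
  have h2 : MDifferentiableAt 𝓘(ℝ, ℝ) (𝓡 n) δ 0 := hδ.mdifferentiableAt (by simp)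
  have hc := mfderiv_comp (I' := (𝓡 n).prod (𝓡 n)) (0 : ℝ)
    (g := fun p : G × G => p.1 * p.2) (f := fun t => (γ t, δ t)) hm (h1.prodMk h2)
  have hl : (fun z : G => z * δ 0) = id := by funext z; simp [hδ0]
  have hr : (fun z : G => γ 0 * z) = id := by funext z; simp [hγ0]
  have hid : ∀ f : G → G, f = id → ∀ (x : G) (w : EuclideanSpace ℝ (Fin n)),
      (mfderiv (𝓡 n) (𝓡 n) f x w : EuclideanSpace ℝ (Fin n)) = w := by
    rintro _ rfl x w
    rw [mfderiv_id]
    rfl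
  have hc1 := DFunLike.congr_fun hc (1 : ℝ)
  refine Eq.trans hc1 ?_
  refine Eq.trans (mfderiv_prod_eq_add_apply hm) ?_
  rw [mfderiv_prodMk h1 h2]
  exact congrArg₂ (· + ·) (hid _ hl (γ 0) _) (hid _ hr (δ 0) _)

/-- The Lie algebra `𝔨 ⊆ 𝔤 = T₁G` of a closed subgroup `K` of a Lie group `G`: the velocities
`γ'(0)` of the smooth curves `γ` in `G` with `γ 0 = 1` that stay in `K`. -/
def subgroupLieAlgebra (K : Subgroup G) : Submodule ℝ (GroupLieAlgebra (𝓡 n) G) where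
  carrier := {X | ∃ γ : ℝ → G, ContMDiff 𝓘(ℝ, ℝ) (𝓡 n) ∞ γ ∧ γ 0 = 1 ∧ (∀ t, γ t ∈ K) ∧ curveVelocity γ = X}
  zero_mem' := by
    refine ⟨fun _ => 1, contMDiff_const, rfl, fun _ => K.one_mem, ?_⟩
    simp only [curveVelocity]
    rw [mfderiv_const]
    rfl
  add_mem' := by
    rintro X Y ⟨γ, hγ, hγ0, hγK, rfl⟩ ⟨δ, hδ, hδ0, hδK, rfl⟩
    refine ⟨fun t => γ t * δ t, hγ.mul hδ, by simp [hγ0, hδ0],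
      fun t => K.mul_mem (hγK t) (hδK t), ?_⟩
    exact curveVelocity_mul hγ hδ hγ0 hδ0
  smul_mem' := by
    rintro c X ⟨γ, hγ, hγ0, hγK, rfl⟩
    refine ⟨fun t => γ (c * t), hγ.comp (contDiff_const.mul contDiff_id).contMDiff, by simp [hγ0],
      fun t => hγK _, ?_⟩
    exact curveVelocity_comp_mul hγ c

/-- `K` is a naturally reductive subgroup of `G` with complement `𝔪`: there is a splitting
`𝔤 = 𝔨 ⊕ 𝔪` of the Lie algebra of `G`, orthogonal for (minus) the Killing form, such that
`[𝔨, 𝔪] ⊆ 𝔪`. -/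
structure IsNaturallyReductive (K : Subgroup G)
    (𝔪 : Submodule ℝ (GroupLieAlgebra (𝓡 n) G)) : Prop where
  isCompl : IsCompl (subgroupLieAlgebra K) 𝔪
  orthogonal : ∀ X ∈ subgroupLieAlgebra K, ∀ Y ∈ 𝔪,
    killingForm ℝ (GroupLieAlgebra (𝓡 n) G) X Y = 0
  lie_mem : ∀ X ∈ subgroupLieAlgebra K, ∀ Y ∈ 𝔪,
    (⁅(X : GroupLieAlgebra (𝓡 n) G), (Y : GroupLieAlgebra (𝓡 n) G)⁆ :
      GroupLieAlgebra (𝓡 n) G) ∈ 𝔪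

end LieAlgebra

/-! ### The associated bundle `G ×_K V` -/

section Bundle

variable {G : Type*} [Group G] {K : Subgroup G} {V : Type*} [AddCommGroup V] [Module ℝ V]

/-- The relation `(g, v) ∼ (g k⁻¹, ρ(k) v)`, `k ∈ K`, on `G × V`. -/
def assocSetoid (ρ : Representation ℝ K V) : Setoid (G × V) where
  r p q := ∃ k : K, q = (p.1 * (k : G)⁻¹, ρ k p.2)
  iseqv :=
    { refl := fun p => ⟨1, by simp⟩
      symm := by
        rintro p q ⟨k, rfl⟩
        exact ⟨k⁻¹, by simp⟩
      trans := by
        rintro p q r ⟨k, rfl⟩ ⟨l, rfl⟩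
        exact ⟨l * k, by simp [mul_assoc]⟩ }

/-- The total space of the homogeneous vector bundle `G ×_K V`. -/
def AssocBundle (ρ : Representation ℝ K V) : Type _ := Quotient (assocSetoid ρ)

variable (ρ : Representation ℝ K V)

/-- The class `[g, v]`. -/
def AssocBundle.mk (g : G) (v : V) : AssocBundle ρ := Quotient.mk (assocSetoid ρ) (g, v)

variable {ρ}

theorem AssocBundle.mk_eq_mk {g h : G} {v w : V} :
    AssocBundle.mk ρ g v = AssocBundle.mk ρ h w ↔ ∃ k : K, h = g * (k : G)⁻¹ ∧ w = ρ k v := by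
  refine Quotient.eq.trans ?_
  constructor
  · rintro ⟨k, hk⟩
    exact ⟨k, (Prod.ext_iff.1 hk).1, (Prod.ext_iff.1 hk).2⟩
  · rintro ⟨k, rfl, rfl⟩
    exact ⟨k, rfl⟩

/-- The bundle projection `[g, v] ↦ gK`. -/
def AssocBundle.proj : AssocBundle ρ → G ⧸ K :=
  Quotient.lift (fun p => (p.1 : G ⧸ K)) (by
    rintro p q ⟨k, rfl⟩
    exact (QuotientGroup.mk_mul_of_mem _ (K.inv_mem k.2)).symm)

/-- The action of `G` on the total space, `g · [h, v] = [g h, v]`. -/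
instance : SMul G (AssocBundle ρ) where
  smul g := Quotient.map (fun p => (g * p.1, p.2)) (by
    rintro p q ⟨k, rfl⟩
    exact ⟨k, by simp [mul_assoc]⟩)

theorem AssocBundle.smul_mk (g h : G) (v : V) :
    g • AssocBundle.mk ρ h v = AssocBundle.mk ρ (g * h) v := rfl

theorem AssocBundle.proj_mk (g : G) (v : V) : (AssocBundle.mk ρ g v).proj = (g : G ⧸ K) := rfl

theorem AssocBundle.exists_eq_mk (e : AssocBundle ρ) (g : G) (h : e.proj = (g : G ⧸ K)) :
    ∃ v, e = AssocBundle.mk ρ g v := by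
  induction e using Quotient.inductionOn with
  | h p =>
    have h' : ((p.1 : G) : G ⧸ K) = (g : G ⧸ K) := h
    have hk : p.1⁻¹ * g ∈ K := QuotientGroup.eq.1 h'
    refine ⟨ρ (⟨p.1⁻¹ * g, hk⟩ : K)⁻¹ p.2, ?_⟩
    change AssocBundle.mk ρ p.1 p.2 = _
    exact AssocBundle.mk_eq_mk.2 ⟨(⟨p.1⁻¹ * g, hk⟩ : K)⁻¹, by simp, rfl⟩

theorem AssocBundle.mk_injective (g : G) : Function.Injective (AssocBundle.mk ρ g) := by
  intro v w h
  obtain ⟨k, hk, rfl⟩ := AssocBundle.mk_eq_mk.1 h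
  have : k = 1 := by
    have h1 : (k : G)⁻¹ = 1 := by simpa using hk
    exact Subtype.ext (by simpa using h1)
  simp [this]

/-- For a set-theoretic section `s` of `G ×_K V → G/K`, the unique map `f : G → V` with
`s(gK) = [g, f(g)]`; it satisfies `f(gk) = ρ(k)⁻¹ f(g)`. -/
def equivariantMap (s : G ⧸ K → AssocBundle ρ) (hs : ∀ x, (s x).proj = x) (g : G) : V :=
  Classical.choose (AssocBundle.exists_eq_mk (s (g : G ⧸ K)) g (hs _))

theorem mk_equivariantMap (s : G ⧸ K → AssocBundle ρ) (hs : ∀ x, (s x).proj = x) (g : G) :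
    AssocBundle.mk ρ g (equivariantMap s hs g) = s (g : G ⧸ K) :=
  (Classical.choose_spec (AssocBundle.exists_eq_mk (s (g : G ⧸ K)) g (hs _))).symm

theorem equivariantMap_eq (s : G ⧸ K → AssocBundle ρ) (hs : ∀ x, (s x).proj = x) {f : G → V}
    (hf : ∀ g : G, s (g : G ⧸ K) = AssocBundle.mk ρ g (f g)) : equivariantMap s hs = f := by
  funext g
  exact AssocBundle.mk_injective g ((mk_equivariantMap s hs g).trans (hf g))

theorem equivariantMap_mul (s : G ⧸ K → AssocBundle ρ) (hs : ∀ x, (s x).proj = x) (g : G)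
    (k : K) : equivariantMap s hs (g * (k : G)) = ρ k⁻¹ (equivariantMap s hs g) := by
  apply AssocBundle.mk_injective (ρ := ρ) (g * (k : G))
  rw [mk_equivariantMap, QuotientGroup.mk_mul_of_mem _ k.2, ← mk_equivariantMap s hs g]
  exact AssocBundle.mk_eq_mk.2 ⟨k⁻¹, by simp, rfl⟩

end Bundle

/-! ### Smooth sections, the action of `G` on them, and the canonical connection -/

section Sections

variable {n : ℕ} {G : Type*} [TopologicalSpace G] [ChartedSpace (EuclideanSpace ℝ (Fin n)) G]
  [Group G] {K : Subgroup G}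
  {V : Type*} [NormedAddCommGroup V] [NormedSpace ℝ V]

/-- The space `Γ(G/K, G ×_K V)` of smooth sections. A section `s` is smooth exactly if the
equivariant map `f : G → V` with `s(gK) = [g, f(g)]` is smooth, since `G → G/K` and
`G × V → G ×_K V` are surjective submersions. -/
@[ext]
structure SmoothSection (n : ℕ) {G : Type*} [TopologicalSpace G]
    [ChartedSpace (EuclideanSpace ℝ (Fin n)) G] [Group G] {K : Subgroup G}
    {V : Type*} [NormedAddCommGroup V] [NormedSpace ℝ V] (ρ : Representation ℝ K V) where
  toFun : G ⧸ K → AssocBundle ρ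
  proj_toFun : ∀ x, (toFun x).proj = x
  smooth : ContMDiff (𝓡 n) 𝓘(ℝ, V) ∞ (equivariantMap toFun proj_toFun)

variable {ρ : Representation ℝ K V}

/-- The `K`-equivariant smooth map `f : G → V` corresponding to a section. -/
def SmoothSection.lift (s : SmoothSection n ρ) : G → V := equivariantMap s.toFun s.proj_toFun

/-- `G` acts on sections by `(g · s)(x) = g · s(g⁻¹ x)`; on the corresponding equivariant maps
this is `(g · f)(h) = f(g⁻¹ h)`. -/
instance [LieGroup (𝓡 n) ∞ G] : SMul G (SmoothSection n ρ) where
  smul g s :=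
    have key : ∀ h : G, g • s.toFun (g⁻¹ • (h : G ⧸ K)) =
        AssocBundle.mk ρ h (s.lift (g⁻¹ * h)) := fun h => by
      have h1 : g⁻¹ • (h : G ⧸ K) = ((g⁻¹ * h : G) : G ⧸ K) := rfl
      rw [h1, ← mk_equivariantMap s.toFun s.proj_toFun, AssocBundle.smul_mk, mul_inv_cancel_left]
      rfl
    have hp : ∀ x : G ⧸ K, (g • s.toFun (g⁻¹ • x)).proj = x := fun x => by
      induction x using QuotientGroup.induction_on with
      | H h => rw [key h]; rfl
    { toFun := fun x => g • s.toFun (g⁻¹ • x)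
      proj_toFun := hp
      smooth := by
        rw [equivariantMap_eq _ hp key]
        exact s.smooth.comp (contMDiff_mul_left (I := 𝓡 n) (n := ∞) (a := g⁻¹)) }

/-- A section is `G`-invariant if `g · s = s` for all `g ∈ G`. -/
def SmoothSection.IsInvariant [LieGroup (𝓡 n) ∞ G] (s : SmoothSection n ρ) : Prop :=
  ∀ g : G, g • s = s

/-- The canonical connection `∇⁻`. Under `T(G/K) = G ×_K 𝔪`, the derivative of a section with
equivariant map `f` corresponds to the map `G → Hom(𝔪, V)` given by `∇⁻_X f = X_L(f)`, where
`X_L` is the left-invariant vector field on `G` of `X ∈ 𝔪`. -/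
def canonicalConnection (𝔪 : Submodule ℝ (GroupLieAlgebra (𝓡 n) G)) (s : SmoothSection n ρ)
    (g : G) : 𝔪 →ₗ[ℝ] V where
  toFun X := mfderiv (𝓡 n) 𝓘(ℝ, V) s.lift g (mulInvariantVectorField X.1 g)
  map_add' X Y := by
    rw [Submodule.coe_add, mulInvariantVectorField_add, Pi.add_apply]
    exact map_add _ _ _
  map_smul' c X := by
    rw [Submodule.coe_smul, mulInvariantVectorField_smul, Pi.smul_apply]
    exact map_smul _ _ _

/-- A section is parallel with respect to `∇⁻` if its covariant derivative vanishes. -/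
def SmoothSection.IsParallel (𝔪 : Submodule ℝ (GroupLieAlgebra (𝓡 n) G))
    (s : SmoothSection n ρ) : Prop :=
  canonicalConnection 𝔪 s = 0

/-- The section `gK ↦ [g, v]` defined by a `K`-invariant vector `v ∈ V`. -/
def sectionOfInvariant (n : ℕ) {G : Type*} [TopologicalSpace G]
    [ChartedSpace (EuclideanSpace ℝ (Fin n)) G] [Group G] {K : Subgroup G}
    {V : Type*} [NormedAddCommGroup V] [NormedSpace ℝ V] (ρ : Representation ℝ K V)
    (v : ρ.invariants) : SmoothSection n ρ :=
  have hwd : ∀ a b : G, QuotientGroup.leftRel K a b →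
      AssocBundle.mk ρ a (v : V) = AssocBundle.mk ρ b (v : V) := fun a b hab => by
    have hk : a⁻¹ * b ∈ K := QuotientGroup.leftRel_apply.1 hab
    exact AssocBundle.mk_eq_mk.2 ⟨(⟨a⁻¹ * b, hk⟩ : K)⁻¹, by simp, (v.2 _).symm⟩
  have hp : ∀ x : G ⧸ K,
      (Quotient.lift (fun g : G => AssocBundle.mk ρ g (v : V)) hwd x).proj = x := fun x => by
    induction x using QuotientGroup.induction_on with
    | H h => rfl
  { toFun := Quotient.lift (fun g : G => AssocBundle.mk ρ g (v : V)) hwd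
    proj_toFun := hp
    smooth := by
      rw [equivariantMap_eq (f := fun _ => (v : V)) _ hp (fun _ => rfl)]
      exact contMDiff_const }

end Sections

end HomogeneousBundle

end

/-! Lifted to `G`, a section is an equivariant map `f : G → V`. Invariance means that `f` is
constant, and equivariance forces the constant to lie in `V^K`; a constant `f` is clearly parallel.
Everything therefore reduces to showing that a parallel section has constant `f`.

The `X ∈ 𝔤` with `X_L f = 0` form a subspace `𝔥` (`annihilator`), which contains `𝔪` when the
section is parallel. It is a Lie subalgebra, because the bracket of two fields acts on functions as
their commutator (`mfderiv_mlieBracket_eq_zero`). Since `[𝔨, 𝔪] ⊆ 𝔪` and `𝔤 = 𝔨 + 𝔪`, the subalgebra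
generated by `𝔪` is an ideal. It is nonzero: if `𝔪 = 0` then `𝔨 = 𝔤`, so `K` would be open as well
as closed, hence all of the connected group `G` (`subgroupLieAlgebra_ne_top`). Simplicity gives `𝔥 =
𝔤` (`lieSubalgebra_eq_top_of_le`); left-invariant fields span every tangent space, so `df = 0` and
`f` is constant. -/

namespace HomogeneousBundle

open Filter Topology VectorField

/-! ### Calculus on manifolds: vanishing derivatives and brackets, read in charts -/

section Calculus

variable {n : ℕ} {M : Type*} [TopologicalSpace M] [ChartedSpace (EuclideanSpace ℝ (Fin n)) M]
  [IsManifold (𝓡 n) ∞ M]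
  {V : Type*} [NormedAddCommGroup V] [NormedSpace ℝ V]

/-- The derivative of a function read in the chart at `x`. -/
theorem fderiv_comp_extChartAt_symm {f : M → V} (hf : ContMDiff (𝓡 n) 𝓘(ℝ, V) ∞ f) (x : M)
    {y : EuclideanSpace ℝ (Fin n)} (hy : y ∈ (extChartAt (𝓡 n) x).target) :
    fderiv ℝ (f ∘ (extChartAt (𝓡 n) x).symm) y =
      (mfderiv (𝓡 n) 𝓘(ℝ, V) f ((extChartAt (𝓡 n) x).symm y)).comp
        (mfderivWithin 𝓘(ℝ, EuclideanSpace ℝ (Fin n)) (𝓡 n) (extChartAt (𝓡 n) x).symm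
          (Set.range (𝓡 n)) y) := by
  have h1 : MDifferentiableAt 𝓘(ℝ, EuclideanSpace ℝ (Fin n)) (𝓡 n)
      (extChartAt (𝓡 n) x).symm y := by
    have := mdifferentiableWithinAt_extChartAt_symm (I := 𝓡 n) hy
    rwa [ModelWithCorners.range_eq_univ, mdifferentiableWithinAt_univ] at this
  have h2 : MDifferentiableAt (𝓡 n) 𝓘(ℝ, V) f ((extChartAt (𝓡 n) x).symm y) :=
    hf.mdifferentiableAt (by simp)
  rw [← mfderiv_eq_fderiv, mfderiv_comp y h2 h1, ModelWithCorners.range_eq_univ,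
    mfderivWithin_univ]

theorem contDiffAt_comp_extChartAt_symm {f : M → V} (hf : ContMDiff (𝓡 n) 𝓘(ℝ, V) ∞ f) (x : M)
    {y : EuclideanSpace ℝ (Fin n)} (hy : y ∈ (extChartAt (𝓡 n) x).target) :
    ContDiffAt ℝ ∞ (f ∘ (extChartAt (𝓡 n) x).symm) y := by
  have h1 : ContMDiffAt 𝓘(ℝ, EuclideanSpace ℝ (Fin n)) (𝓡 n) ∞
      (extChartAt (𝓡 n) x).symm y := by
    have := contMDiffWithinAt_extChartAt_symm_range (I := 𝓡 n) (n := ∞) x hy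
    rwa [ModelWithCorners.range_eq_univ, contMDiffWithinAt_univ] at this
  exact ((hf.contMDiffAt).comp y h1).contDiffAt

/-- A smooth function with vanishing derivative on a connected manifold is constant. -/
theorem eq_of_mfderiv_eq_zero [PreconnectedSpace M] {f : M → V}
    (hf : ContMDiff (𝓡 n) 𝓘(ℝ, V) ∞ f)
    (h : ∀ x, mfderiv (𝓡 n) 𝓘(ℝ, V) f x = 0) (x y : M) : f x = f y := by
  have hloc : IsLocallyConstant f := by
    rw [IsLocallyConstant.iff_eventually_eq]
    intro x
    have hy := extChartAt_target_mem_nhds (I := 𝓡 n) x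
    obtain ⟨ε, hε, hball⟩ := Metric.mem_nhds_iff.1 hy
    have hev : ∀ᶠ z in 𝓝 x, extChartAt (𝓡 n) x z ∈ Metric.ball (extChartAt (𝓡 n) x x) ε :=
      (continuousAt_extChartAt x).eventually (Metric.ball_mem_nhds _ hε)
    filter_upwards [hev, extChartAt_source_mem_nhds (I := 𝓡 n) x] with z hz hzs
    -- The chart reading of `f` has zero derivative on a ball inside the chart target, and a ball is
    -- convex.
    have key := (convex_ball (extChartAt (𝓡 n) x x) ε).is_const_of_fderivWithin_eq_zero (𝕜 := ℝ)
      (f := f ∘ (extChartAt (𝓡 n) x).symm)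
      (fun w hw => ((contDiffAt_comp_extChartAt_symm hf x (hball hw)).differentiableAt
        (by simp)).differentiableWithinAt)
      (fun w hw => by
        rw [fderivWithin_of_isOpen Metric.isOpen_ball hw,
          fderiv_comp_extChartAt_symm hf x (hball hw), h]
        exact ContinuousLinearMap.zero_comp _)
      hz (Metric.mem_ball_self hε)
    simpa only [Function.comp_apply, (extChartAt (𝓡 n) x).left_inv hzs, extChartAt_to_inv]
      using key
  exact hloc.apply_eq_of_isPreconnected isPreconnected_univ (Set.mem_univ _) (Set.mem_univ _)

/-- If two vector fields annihilate a function, so does their Lie bracket. -/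
theorem mfderiv_mlieBracket_eq_zero {f : M → V} (hf : ContMDiff (𝓡 n) 𝓘(ℝ, V) ∞ f)
    {X Y : Π x : M, TangentSpace (𝓡 n) x}
    (hX : MDifferentiable (𝓡 n) (𝓡 n).tangent (fun x => (X x : TangentBundle (𝓡 n) M)))
    (hY : MDifferentiable (𝓡 n) (𝓡 n).tangent (fun x => (Y x : TangentBundle (𝓡 n) M)))
    (hfX : ∀ x, mfderiv (𝓡 n) 𝓘(ℝ, V) f x (X x) = 0)
    (hfY : ∀ x, mfderiv (𝓡 n) 𝓘(ℝ, V) f x (Y x) = 0) (x : M) :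
    mfderiv (𝓡 n) 𝓘(ℝ, V) f x (mlieBracket (𝓡 n) X Y x) = 0 := by
  have : IsManifold (𝓡 n) 2 M := IsManifold.of_le (n := ∞) (by exact ENat.LEInfty.out)
  have : IsManifold (𝓡 n) 1 M := IsManifold.of_le (n := ∞) (by exact ENat.LEInfty.out)
  -- Annihilation passes to the chart on its whole target: pulling `Z` back inverts the derivative
  -- of `φ.symm`, which the chain rule for `f ∘ φ.symm` then cancels.
  have hpull : ∀ Z : (Π x : M, TangentSpace (𝓡 n) x),
      (∀ x, mfderiv (𝓡 n) 𝓘(ℝ, V) f x (Z x) = 0) →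
      ∀ y ∈ (extChartAt (𝓡 n) x).target, fderiv ℝ (f ∘ (extChartAt (𝓡 n) x).symm) y
        (mpullbackWithin 𝓘(ℝ, EuclideanSpace ℝ (Fin n)) (𝓡 n) (extChartAt (𝓡 n) x).symm Z
          (Set.range (𝓡 n)) y) = 0 := by
    intro Z hZ y hy
    rw [fderiv_comp_extChartAt_symm hf x hy]
    refine Eq.trans ?_ (hZ ((extChartAt (𝓡 n) x).symm y))
    refine congrArg (mfderiv (𝓡 n) 𝓘(ℝ, V) f ((extChartAt (𝓡 n) x).symm y)) ?_
    exact (isInvertible_mfderivWithin_extChartAt_symm hy).self_apply_inverse _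
  have hdiff : ∀ Z : (Π x : M, TangentSpace (𝓡 n) x),
      MDifferentiable (𝓡 n) (𝓡 n).tangent (fun x => (Z x : TangentBundle (𝓡 n) M)) →
      DifferentiableAt ℝ (mpullbackWithin 𝓘(ℝ, EuclideanSpace ℝ (Fin n)) (𝓡 n)
        (extChartAt (𝓡 n) x).symm Z (Set.range (𝓡 n))) (extChartAt (𝓡 n) x x) := by
    intro Z hZ
    have := MDifferentiableWithinAt.differentiableWithinAt_mpullbackWithin_vectorField
      (s := Set.univ) (hZ x).mdifferentiableWithinAt
    rw [Set.preimage_univ, Set.univ_inter, ModelWithCorners.range_eq_univ] at this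
    rw [ModelWithCorners.range_eq_univ]
    exact differentiableWithinAt_univ.1 this
  set φ := extChartAt (𝓡 n) x with hφ
  set X' : EuclideanSpace ℝ (Fin n) → EuclideanSpace ℝ (Fin n) :=
    mpullbackWithin 𝓘(ℝ, EuclideanSpace ℝ (Fin n)) (𝓡 n) φ.symm X (Set.range (𝓡 n))
  set Y' : EuclideanSpace ℝ (Fin n) → EuclideanSpace ℝ (Fin n) :=
    mpullbackWithin 𝓘(ℝ, EuclideanSpace ℝ (Fin n)) (𝓡 n) φ.symm Y (Set.range (𝓡 n))
  have hloc : φ.target ∈ 𝓝 (φ x) := extChartAt_target_mem_nhds (I := 𝓡 n) x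
  have hzero : fderiv ℝ (f ∘ φ.symm) (φ x) (lieBracket ℝ X' Y' (φ x)) = 0 := by
    -- The bracket differentiates a function as a commutator. Each term differentiates a function
    -- that vanishes near `φ x`, hence is zero.
    have h1 := fderiv_apply_lieBracket
      (contDiffAt_comp_extChartAt_symm hf x (mem_extChartAt_target x))
      (by rw [minSmoothness_of_isRCLikeNormedField]; exact ENat.LEInfty.out)
      (hdiff Y hY) (hdiff X hX)
    have hev : ∀ Z : EuclideanSpace ℝ (Fin n) → EuclideanSpace ℝ (Fin n),
        (∀ y ∈ φ.target, fderiv ℝ (f ∘ φ.symm) y (Z y) = 0) →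
        fderiv ℝ (fun y => fderiv ℝ (f ∘ φ.symm) y (Z y)) (φ x) = 0 := by
      intro Z hZ
      have : (fun y => fderiv ℝ (f ∘ φ.symm) y (Z y)) =ᶠ[𝓝 (φ x)] fun _ => (0 : V) := by
        filter_upwards [hloc] with y hy using hZ y hy
      rw [this.fderiv_eq, fderiv_fun_const]
      rfl
    refine h1.trans ?_
    rw [hev Y' (hpull Y hfY), hev X' (hpull X hfX)]
    exact sub_self (0 : V)
  have hfφ : mfderiv (𝓡 n) 𝓘(ℝ, V) f x =
      (fderiv ℝ (f ∘ φ.symm) (φ x)).comp (mfderiv (𝓡 n) 𝓘(ℝ, EuclideanSpace ℝ (Fin n)) φ x) := by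
    have h2 : MDifferentiableAt 𝓘(ℝ, EuclideanSpace ℝ (Fin n)) 𝓘(ℝ, V) (f ∘ φ.symm) (φ x) :=
      ((contDiffAt_comp_extChartAt_symm hf x (mem_extChartAt_target x)).differentiableAt
        (by simp)).mdifferentiableAt
    have h3 : MDifferentiableAt (𝓡 n) 𝓘(ℝ, EuclideanSpace ℝ (Fin n)) φ x :=
      mdifferentiableAt_extChartAt (mem_chart_source _ x)
    have e := mfderiv_comp x h2 h3
    rw [mfderiv_eq_fderiv] at e
    refine Eq.trans ?_ e
    apply Filter.EventuallyEq.mfderiv_eq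
    filter_upwards [extChartAt_source_mem_nhds (I := 𝓡 n) x] with z hz
    exact congrArg f ((extChartAt (𝓡 n) x).left_inv hz).symm
  let b : EuclideanSpace ℝ (Fin n) := lieBracket ℝ X' Y' (φ x)
  -- The manifold bracket is defined as the bracket in the chart, carried back by the inverse of
  -- `dφ`.
  have hbr : mlieBracket (𝓡 n) X Y x =
      (mfderiv (𝓡 n) 𝓘(ℝ, EuclideanSpace ℝ (Fin n)) φ x).inverse b := by
    rw [← mlieBracketWithin_univ, mlieBracketWithin_apply,
      Set.preimage_univ, ModelWithCorners.range_eq_univ, Set.univ_inter]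
    simp only [b, X', Y', ← lieBracketWithin_univ, ModelWithCorners.range_eq_univ]
    rfl
  rw [hbr, hfφ]
  refine Eq.trans ?_ hzero
  refine congrArg (fderiv ℝ (f ∘ φ.symm) (φ x)) ?_
  exact (isInvertible_mfderiv_extChartAt (mem_extChartAt_source x)).self_apply_inverse _

end Calculus

/-! ### Lie theory: subgroups of full Lie algebra, generation by `𝔪`, annihilators -/

section LieTheory

variable {n : ℕ} {G : Type*} [TopologicalSpace G] [ChartedSpace (EuclideanSpace ℝ (Fin n)) G]
  [Group G] [LieGroup (𝓡 n) ∞ G]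

theorem _root_.ContMDiff.listProd_map {ι E : Type*} [NormedAddCommGroup E] [NormedSpace ℝ E]
    (l : List ι) {F : ι → E → G} (hF : ∀ i, ContMDiff 𝓘(ℝ, E) (𝓡 n) ∞ (F i)) :
    ContMDiff 𝓘(ℝ, E) (𝓡 n) ∞ (fun x => (l.map fun i => F i x).prod) := by
  induction l with
  | nil => simpa using contMDiff_const
  | cons i l ih => simp only [List.map_cons, List.prod_cons]; exact (hF i).mul ih

/-- A map from the model space to the group whose derivative is bijective at the origin has image
a neighbourhood of the image of the origin. -/
theorem range_mem_nhds_of_mfderiv {Ψ : EuclideanSpace ℝ (Fin n) → G}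
    (hΨ : ContMDiff 𝓘(ℝ, EuclideanSpace ℝ (Fin n)) (𝓡 n) ∞ Ψ)
    (h : ∀ i, (mfderiv 𝓘(ℝ, EuclideanSpace ℝ (Fin n)) (𝓡 n) Ψ 0 (EuclideanSpace.single i 1) :
      EuclideanSpace ℝ (Fin n)) = EuclideanSpace.single i 1) :
    Set.range Ψ ∈ 𝓝 (Ψ 0) := by
  have : IsManifold (𝓡 n) 1 G := IsManifold.of_le (n := ∞) (by exact ENat.LEInfty.out)
  set φ := extChartAt (𝓡 n) (Ψ 0) with hφ
  have hφs : ContMDiffAt (𝓡 n) 𝓘(ℝ, EuclideanSpace ℝ (Fin n)) ∞ φ (Ψ 0) :=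
    contMDiffAt_extChartAt
  have hsm : ContDiffAt ℝ ∞ (φ ∘ Ψ) 0 := (hφs.comp 0 hΨ.contMDiffAt).contDiffAt
  -- A chart has identity derivative at its own centre, so `φ ∘ Ψ` inherits the derivative of `Ψ`,
  -- and the inverse function theorem applies to it.
  have hd : fderiv ℝ (φ ∘ Ψ) 0 = ContinuousLinearMap.id ℝ (EuclideanSpace ℝ (Fin n)) := by
    have e := mfderiv_comp (0 : EuclideanSpace ℝ (Fin n))
      (hφs.mdifferentiableAt (by simp)) (hΨ.mdifferentiableAt (by simp))
    rw [mfderiv_eq_fderiv, hφ, mfderiv_extChartAt_self] at e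
    apply ContinuousLinearMap.coe_injective
    refine (EuclideanSpace.basisFun (Fin n) ℝ).toBasis.ext fun i => ?_
    simp only [OrthonormalBasis.coe_toBasis, EuclideanSpace.basisFun_apply]
    exact (DFunLike.congr_fun e _).trans (h i)
  have hs : HasStrictFDerivAt (φ ∘ Ψ)
      (ContinuousLinearEquiv.refl ℝ (EuclideanSpace ℝ (Fin n)) :
        EuclideanSpace ℝ (Fin n) →L[ℝ] EuclideanSpace ℝ (Fin n)) 0 := by
    have := hsm.hasStrictFDerivAt (by simp)
    rwa [hd] at this
  have hmap := hs.map_nhds_eq_of_equiv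
  have h1 : ∀ᶠ x in 𝓝 (0 : EuclideanSpace ℝ (Fin n)), φ.symm ((φ ∘ Ψ) x) ∈ Set.range Ψ := by
    filter_upwards [hΨ.continuous.continuousAt.eventually
      (extChartAt_source_mem_nhds (I := 𝓡 n) (Ψ 0))] with x hx
    exact ⟨x, (φ.left_inv hx).symm⟩
  have h2 : ∀ᶠ y in 𝓝 (φ (Ψ 0)), φ.symm y ∈ Set.range Ψ := by
    have : ∀ᶠ y in map (φ ∘ Ψ) (𝓝 0), φ.symm y ∈ Set.range Ψ := h1
    rwa [hmap] at this
  filter_upwards [(continuousAt_extChartAt (I := 𝓡 n) (Ψ 0)).eventually h2,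
    extChartAt_source_mem_nhds (I := 𝓡 n) (Ψ 0)] with g hg hgs
  rwa [φ.left_inv hgs] at hg

/-- A subgroup of full Lie algebra is open. -/
theorem isOpen_of_subgroupLieAlgebra_eq_top {K : Subgroup G}
    (hK : subgroupLieAlgebra (n := n) K = ⊤) : IsOpen (K : Set G) := by
  have : IsTopologicalGroup G := topologicalGroup_of_lieGroup (𝓡 n) ∞
  have hex : ∀ i : Fin n, ∃ γ : ℝ → G, ContMDiff 𝓘(ℝ, ℝ) (𝓡 n) ∞ γ ∧ γ 0 = 1 ∧ (∀ t, γ t ∈ K) ∧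
      curveVelocity γ = EuclideanSpace.single i (1 : ℝ) := fun i => by
    let e : GroupLieAlgebra (𝓡 n) G := EuclideanSpace.single (𝕜 := ℝ) i 1
    have : e ∈ subgroupLieAlgebra (n := n) K := hK ▸ Submodule.mem_top
    exact this
  choose γ hγ hγ0 hγK hγv using hex
  -- Coordinates of the second kind: an ordered product of curves in `K`, one per basis vector. All
  -- values lie in `K`, and the derivative at `0` is the identity.
  set Ψ : EuclideanSpace ℝ (Fin n) → G := fun x =>
    ((List.finRange n).map fun i => γ i (x i)).prod with hΨdef
  have hΨ : ContMDiff 𝓘(ℝ, EuclideanSpace ℝ (Fin n)) (𝓡 n) ∞ Ψ :=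
    ContMDiff.listProd_map _ fun i =>
      (hγ i).comp (EuclideanSpace.proj (𝕜 := ℝ) i).contDiff.contMDiff
  have hΨ0 : Ψ 0 = 1 := by simp [hΨdef, hγ0]
  -- On the `i`-th axis every other factor is `γ j 0 = 1`, and `i` occurs exactly once in the list.
  have hsingle : ∀ i (t : ℝ), Ψ (t • EuclideanSpace.single i (1 : ℝ)) = γ i t := fun i t => by
    rw [hΨdef]
    dsimp only
    rw [List.prod_map_eq_pow_single i]
    · rw [List.count_eq_one_of_mem (List.nodup_finRange n) (List.mem_finRange i)]
      simp
    · intro j hj _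
      simp [hj, hγ0]
  have hd : ∀ i, (mfderiv 𝓘(ℝ, EuclideanSpace ℝ (Fin n)) (𝓡 n) Ψ 0 (EuclideanSpace.single i 1) :
      EuclideanSpace ℝ (Fin n)) = EuclideanSpace.single i 1 := fun i => by
    have hl : HasMFDerivAt 𝓘(ℝ, ℝ) 𝓘(ℝ, EuclideanSpace ℝ (Fin n))
        (fun t : ℝ => t • EuclideanSpace.single i (1 : ℝ)) 0
        ((ContinuousLinearMap.id ℝ ℝ).smulRight (EuclideanSpace.single i (1 : ℝ))) :=
      ((hasFDerivAt_id (𝕜 := ℝ) (0 : ℝ)).smul_const _).hasMFDerivAt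
    have hc : HasMFDerivAt 𝓘(ℝ, EuclideanSpace ℝ (Fin n)) (𝓡 n) Ψ
        ((0 : ℝ) • EuclideanSpace.single i (1 : ℝ))
        (mfderiv 𝓘(ℝ, EuclideanSpace ℝ (Fin n)) (𝓡 n) Ψ
          ((0 : ℝ) • EuclideanSpace.single i (1 : ℝ))) :=
      (hΨ.mdifferentiableAt (by simp)).hasMFDerivAt
    have h2 := (HasMFDerivAt.comp (0 : ℝ) hc hl).mfderiv
    have h3 : (fun t : ℝ => Ψ (t • EuclideanSpace.single i (1 : ℝ))) = γ i := funext (hsingle i)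
    have h4 : curveVelocity (n := n) (fun t : ℝ => Ψ (t • EuclideanSpace.single i (1 : ℝ))) =
        mfderiv 𝓘(ℝ, EuclideanSpace ℝ (Fin n)) (𝓡 n) Ψ
          ((0 : ℝ) • EuclideanSpace.single i (1 : ℝ))
          ((1 : ℝ) • EuclideanSpace.single i (1 : ℝ)) := DFunLike.congr_fun h2 (1 : ℝ)
    rw [h3, hγv, zero_smul, one_smul] at h4
    exact h4.symm
  apply Subgroup.isOpen_of_mem_nhds K (g := Ψ 0)
  refine mem_of_superset (range_mem_nhds_of_mfderiv hΨ hd) ?_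
  rintro _ ⟨x, rfl⟩
  refine K.list_prod_mem fun y hy => ?_
  obtain ⟨i, -, rfl⟩ := List.mem_map.1 hy
  exact hγK i _

/-- A proper closed subgroup of a connected Lie group has proper Lie algebra. -/
theorem subgroupLieAlgebra_ne_top [ConnectedSpace G] {K : Subgroup G}
    (hKclosed : IsClosed (K : Set G)) (hK : K ≠ ⊤) : subgroupLieAlgebra (n := n) K ≠ ⊤ := fun h => by
  have hcl : IsClopen (K : Set G) := ⟨hKclosed, isOpen_of_subgroupLieAlgebra_eq_top h⟩
  have := hcl.eq_univ ⟨1, K.one_mem⟩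
  exact hK (SetLike.coe_injective (by simpa using this))

/-- A Lie subalgebra that contains a nonzero complement `𝔪` of a subspace `𝔨` with
`[𝔨, 𝔪] ⊆ 𝔪` is everything if the Lie algebra is simple. -/
theorem lieSubalgebra_eq_top_of_le {L : Type*} [LieRing L] [LieAlgebra ℝ L]
    [LieAlgebra.IsSimple ℝ L] {𝔨 𝔪 : Submodule ℝ L} (hsup : 𝔨 ⊔ 𝔪 = ⊤) (h𝔪 : 𝔪 ≠ ⊥)
    (hlie : ∀ X ∈ 𝔨, ∀ Y ∈ 𝔪, ⁅X, Y⁆ ∈ 𝔪) {𝔥 : LieSubalgebra ℝ L}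
    (h : 𝔪 ≤ 𝔥.toSubmodule) : 𝔥 = ⊤ := by
  -- The argument uses the subalgebra generated by `𝔪`, since `𝔥` itself is not known to be stable
  -- under `𝔨`. For `S`, stability is checked on generators and propagates because `ad X` is a
  -- derivation.
  set S := LieSubalgebra.lieSpan ℝ L (𝔪 : Set L) with hS
  have hm : ∀ Y ∈ 𝔪, Y ∈ S := fun Y hY => LieSubalgebra.subset_lieSpan hY
  have hk : ∀ X ∈ 𝔨, ∀ Y ∈ S, ⁅X, Y⁆ ∈ S := fun X hX Y hY => by
    induction hY using LieSubalgebra.lieSpan_induction with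
    | mem Y hY => exact hm _ (hlie X hX Y hY)
    | zero => simp
    | smul c Y _ ih => rw [lie_smul]; exact S.smul_mem c ih
    | add Y Z _ _ hY hZ => rw [lie_add]; exact S.add_mem hY hZ
    | lie Y Z hY' hZ' hY hZ =>
      rw [leibniz_lie]
      exact S.add_mem (S.lie_mem hY hZ') (S.lie_mem hY' hZ)
  let I : LieIdeal ℝ L :=
    { S.toSubmodule with
      lie_mem := fun {X Y} hY => by
        obtain ⟨A, hA, B, hB, rfl⟩ := Submodule.mem_sup.1 (hsup ▸ Submodule.mem_top : X ∈ 𝔨 ⊔ 𝔪)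
        rw [add_lie]
        exact S.add_mem (hk A hA Y hY) (S.lie_mem (hm B hB) hY) }
  have hI : I = ⊤ := by
    refine (LieAlgebra.IsSimple.eq_bot_or_eq_top I).resolve_left fun hbot => h𝔪 ?_
    refine (Submodule.eq_bot_iff _).2 fun Y hY => ?_
    have : Y ∈ I := hm Y hY
    rwa [hbot, LieSubmodule.mem_bot] at this
  refine eq_top_iff.2 fun X _ => ?_
  have : X ∈ I := hI ▸ LieSubmodule.mem_top X
  exact LieSubalgebra.lieSpan_le.2 h this

variable {V : Type*} [NormedAddCommGroup V] [NormedSpace ℝ V]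

/-- The Lie subalgebra of the left-invariant vector fields that annihilate `f`. -/
def annihilator {f : G → V} (hf : ContMDiff (𝓡 n) 𝓘(ℝ, V) ∞ f) :
    LieSubalgebra ℝ (GroupLieAlgebra (𝓡 n) G) where
  carrier := {X | ∀ g : G, (mfderiv (𝓡 n) 𝓘(ℝ, V) f g (mulInvariantVectorField X g) : V) = 0}
  zero_mem' g := by
    have h : mulInvariantVectorField (0 : GroupLieAlgebra (𝓡 n) G) g = 0 := map_zero _
    rw [h]
    exact map_zero _
  add_mem' {X Y} hX hY g := by
    rw [mulInvariantVectorField_add, Pi.add_apply]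
    refine (map_add (mfderiv (𝓡 n) 𝓘(ℝ, V) f g) _ _).trans ?_
    exact (congrArg₂ (fun a b : V => a + b) (hX g) (hY g)).trans (add_zero _)
  smul_mem' c X hX g := by
    rw [mulInvariantVectorField_smul, Pi.smul_apply]
    refine (map_smul (mfderiv (𝓡 n) 𝓘(ℝ, V) f g) _ _).trans ?_
    exact (congrArg (fun a : V => c • a) (hX g)).trans (smul_zero (A := V) c)
  lie_mem' {X Y} hX hY g := by
    -- The field of `⁅X, Y⁆` is the bracket of the fields of `X` and `Y`, because that bracket is
    -- again left-invariant.
    rw [GroupLieAlgebra.bracket_def, mulInvariantVector_mlieBracket]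
    exact mfderiv_mlieBracket_eq_zero hf (mdifferentiable_mulInvariantVectorField X)
      (mdifferentiable_mulInvariantVectorField Y) hX hY g

/-- A function annihilated by all left-invariant vector fields has vanishing derivative. -/
theorem mfderiv_eq_zero_of_annihilator_eq_top {f : G → V} (hf : ContMDiff (𝓡 n) 𝓘(ℝ, V) ∞ f)
    (h : annihilator hf = ⊤) (g : G) : mfderiv (𝓡 n) 𝓘(ℝ, V) f g = 0 := by
  have hL : ∀ a b : G, MDifferentiableAt (𝓡 n) (𝓡 n) (fun x : G => a * x) b := fun a b =>
    (contMDiff_mul_left (I := 𝓡 n) (n := ∞) (a := a)).mdifferentiableAt (by simp)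
  have hfg : ∀ b, MDifferentiableAt (𝓡 n) 𝓘(ℝ, V) f b := fun b => hf.mdifferentiableAt (by simp)
  -- The value of `X_L` at `g` is the image of `X` under the derivative of left translation, so the
  -- hypothesis kills `d(f ∘ L_g)` at `1`. Translating back by `g⁻¹` gives `df` at `g`.
  have h1 : mfderiv (𝓡 n) 𝓘(ℝ, V) (fun x => f (g * x)) 1 = 0 := by
    ext X
    have hX : X ∈ annihilator hf := h ▸ LieSubalgebra.mem_top X
    have e := mfderiv_comp (1 : G) (hfg (g * 1)) (hL g 1)
    refine (DFunLike.congr_fun e X).trans ?_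
    have key : ∀ b, b = g → ∀ w : EuclideanSpace ℝ (Fin n),
        (mfderiv (𝓡 n) 𝓘(ℝ, V) f g w : V) = 0 → (mfderiv (𝓡 n) 𝓘(ℝ, V) f b w : V) = 0 := by
      rintro _ rfl w hw
      exact hw
    exact key (g * 1) (mul_one g) _ (hX g)
  have h2 : ∀ b : G, b = 1 → mfderiv (𝓡 n) 𝓘(ℝ, V) (fun x => f (g * x)) b = 0 := by
    rintro _ rfl
    exact h1
  have e := mfderiv_comp g (I' := 𝓡 n) (g := fun x => f (g * x)) (f := fun x => g⁻¹ * x)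
    ((hfg _).comp _ (hL g _)) (hL g⁻¹ g)
  have hfe : (fun x => f (g * x)) ∘ (fun x => g⁻¹ * x) = f := by funext x; simp
  rw [hfe, h2 _ (inv_mul_cancel g)] at e
  exact e.trans (ContinuousLinearMap.zero_comp _)

end LieTheory

/-! ### Sections and their equivariant maps -/

section Sections

variable {n : ℕ} {G : Type*} [TopologicalSpace G] [ChartedSpace (EuclideanSpace ℝ (Fin n)) G]
  [Group G] {K : Subgroup G} {V : Type*} [NormedAddCommGroup V] [NormedSpace ℝ V]
  {ρ : Representation ℝ K V}

theorem SmoothSection.lift_injective :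
    Function.Injective (SmoothSection.lift : SmoothSection n ρ → G → V) := fun s t h => by
  refine SmoothSection.ext (funext fun x => ?_)
  induction x using QuotientGroup.induction_on with
  | H g =>
    rw [← mk_equivariantMap s.toFun s.proj_toFun, ← mk_equivariantMap t.toFun t.proj_toFun]
    exact congrArg _ (congrFun h g)

theorem lift_sectionOfInvariant (v : ρ.invariants) :
    (sectionOfInvariant n ρ v).lift = fun _ => (v : V) :=
  equivariantMap_eq _ _ fun _ => rfl

theorem SmoothSection.lift_smul [LieGroup (𝓡 n) ∞ G] (g : G) (s : SmoothSection n ρ) (h : G) :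
    (g • s).lift h = s.lift (g⁻¹ * h) := by
  refine congrFun (equivariantMap_eq (f := fun h => s.lift (g⁻¹ * h)) _ _ fun h => ?_) h
  change g • s.toFun (g⁻¹ • (h : G ⧸ K)) = _
  have h1 : g⁻¹ • (h : G ⧸ K) = ((g⁻¹ * h : G) : G ⧸ K) := rfl
  rw [h1, ← mk_equivariantMap s.toFun s.proj_toFun, AssocBundle.smul_mk, mul_inv_cancel_left]
  rfl

/-- A section is invariant if and only if its equivariant map is constant. -/
theorem SmoothSection.isInvariant_iff [LieGroup (𝓡 n) ∞ G] {s : SmoothSection n ρ} :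
    s.IsInvariant ↔ ∀ g, s.lift g = s.lift 1 := by
  constructor
  · intro h g
    have := SmoothSection.lift_smul g⁻¹ s 1
    rw [h] at this
    simpa using this.symm
  · intro h g
    refine SmoothSection.lift_injective (funext fun a => ?_)
    rw [SmoothSection.lift_smul, h, ← h a]

/-- A section with constant equivariant map comes from an invariant vector. -/
theorem SmoothSection.exists_sectionOfInvariant_eq {s : SmoothSection n ρ}
    (h : ∀ g, s.lift g = s.lift 1) : ∃ v, sectionOfInvariant n ρ v = s := by
  refine ⟨⟨s.lift 1, fun k => ?_⟩, SmoothSection.lift_injective ?_⟩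
  -- Equivariance at `k⁻¹` reads `f(k⁻¹) = ρ(k) f(1)`, and constancy of `f` makes the left side
  -- `f(1)`.
  · have := equivariantMap_mul s.toFun s.proj_toFun 1 k⁻¹
    rw [inv_inv] at this
    exact this.symm.trans (h _)
  · rw [lift_sectionOfInvariant]
    exact funext fun g => (h g).symm

theorem SmoothSection.isParallel_of_lift_eq {s : SmoothSection n ρ}
    (𝔪 : Submodule ℝ (GroupLieAlgebra (𝓡 n) G)) (h : ∀ g, s.lift g = s.lift 1) :
    s.IsParallel 𝔪 := by
  have hs : s.lift = fun _ => s.lift 1 := funext h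
  funext g
  ext X
  change mfderiv (𝓡 n) 𝓘(ℝ, V) s.lift g (mulInvariantVectorField X.1 g) = 0
  rw [hs, mfderiv_const]
  rfl

/-- A parallel section has constant equivariant map. -/
theorem SmoothSection.IsParallel.lift_eq [LieGroup (𝓡 n) ∞ G] [ConnectedSpace G]
    [LieAlgebra.IsSimple ℝ (GroupLieAlgebra (𝓡 n) G)] (hKclosed : IsClosed (K : Set G))
    (hK : K ≠ ⊤) {𝔪 : Submodule ℝ (GroupLieAlgebra (𝓡 n) G)} (h𝔪 : IsNaturallyReductive K 𝔪)
    {s : SmoothSection n ρ} (hs : s.IsParallel 𝔪) (g : G) : s.lift g = s.lift 1 := by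
  have hne : 𝔪 ≠ ⊥ := fun h => subgroupLieAlgebra_ne_top hKclosed hK <| by
    have := h𝔪.isCompl.sup_eq_top
    rwa [h, sup_bot_eq] at this
  have hsm : ContMDiff (𝓡 n) 𝓘(ℝ, V) ∞ s.lift := s.smooth
  have hle : 𝔪 ≤ (annihilator hsm).toSubmodule := fun X hX a =>
    DFunLike.congr_fun (congrFun hs a) (⟨X, hX⟩ : 𝔪)
  have htop := lieSubalgebra_eq_top_of_le h𝔪.isCompl.sup_eq_top hne h𝔪.lie_mem hle
  exact eq_of_mfderiv_eq_zero hsm (mfderiv_eq_zero_of_annihilator_eq_top hsm htop) g 1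

end Sections

end HomogeneousBundle

theorem mainTheorem12 {n : ℕ} {G : Type*} [Group G] [TopologicalSpace G] [T2Space G]
    [CompactSpace G] [ConnectedSpace G] [ChartedSpace (EuclideanSpace ℝ (Fin n)) G]
    [LieGroup (𝓡 n) ∞ G] [LieAlgebra.IsSimple ℝ (GroupLieAlgebra (𝓡 n) G)]
    (K : Subgroup G) (hKclosed : IsClosed (K : Set G)) (hK : K ≠ ⊤)
    (𝔪 : Submodule ℝ (GroupLieAlgebra (𝓡 n) G)) (h𝔪 : HomogeneousBundle.IsNaturallyReductive K 𝔪)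
    {V : Type*} [NormedAddCommGroup V] [NormedSpace ℝ V] [FiniteDimensional ℝ V]
    (ρ : Representation ℝ K V) (hρ : Continuous fun p : K × V => ρ p.1 p.2) :
    Set.BijOn (HomogeneousBundle.sectionOfInvariant n ρ) Set.univ
        {s : HomogeneousBundle.SmoothSection n ρ | s.IsParallel 𝔪} ∧
      ∀ s : HomogeneousBundle.SmoothSection n ρ, s.IsParallel 𝔪 ↔ s.IsInvariant := by
  refine ⟨⟨fun v _ => ?_, fun v _ w _ h => ?_, fun s hs => ?_⟩, fun s => ⟨fun hs => ?_, fun hs => ?_⟩⟩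
  · refine HomogeneousBundle.SmoothSection.isParallel_of_lift_eq 𝔪 fun g => ?_
    rw [HomogeneousBundle.lift_sectionOfInvariant]
  · have := congrArg (fun s => HomogeneousBundle.SmoothSection.lift s 1) h
    simp only [HomogeneousBundle.lift_sectionOfInvariant] at this
    exact Subtype.ext this
  · obtain ⟨v, hv⟩ := HomogeneousBundle.SmoothSection.exists_sectionOfInvariant_eq
      (HomogeneousBundle.SmoothSection.IsParallel.lift_eq hKclosed hK h𝔪 hs)
    exact ⟨v, Set.mem_univ _, hv⟩
  · exact HomogeneousBundle.SmoothSection.isInvariant_iff.2 (hs.lift_eq hKclosed hK h𝔪)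
  · exact HomogeneousBundle.SmoothSection.isParallel_of_lift_eq 𝔪
      (HomogeneousBundle.SmoothSection.isInvariant_iff.1 hs)
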